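/- Let $\Theta$ be a finite set, $\mathcal H,\mathcal K$ finite-dimensional complex Hilbert spaces, $u_\theta\in\mathcal H$ ($\theta\in\Theta$) vectors (not necessarily normalized), $L_\theta=|u_\theta\rangle\langle u_\theta|$, and let each $M_\theta$ be a nonnegative multiple of an orthogonal projector on $\mathcal K$, with $\|L_\theta\|=\|M_\theta\|$ (operator norm) for every $\theta$. Decompose $\Theta$ into components $\kappa$: $\theta$ and $\theta'$ belong to the same component iff there is a finite chain $\theta=\theta_1,\dots,\theta_k=\theta'$ ($k\ge 1$) with $L_{\theta_i}L_{\theta_{i+1}}\neq 0$ for $1\le i<k$; let $\kappa(\theta)$ denote the component of $\theta$. Call families $\{u_\theta\}_{\theta\in\Theta}$ and $\{v_\theta\}_{\theta\in\Theta}$ unitarily equivalent if there is a unitary $W:\mathrm{span}\{u_\theta\}\to\mathrm{span}\{v_\theta\}$ with $Wu_\theta=v_\theta$ for all $\theta$. Then there is a completely positive linear map $\Lambda:\mathcal L(\mathcal H)\to\mathcal L(\mathcal K)$ with $\Lambda(I_{\mathcal H})\le I_{\mathcal K}$ and $\Lambda(L_\theta)=M_\theta$ for all $\theta\in\Theta$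 if and only if there is a family $\mathcal V=\{v_\theta\}_{\theta\in\Theta}$ of vectors in some $\mathbb C^n$, unitarily equivalent to $\mathcal U=\{u_\theta\}_{\theta\in\Theta}$, and positive integers $d_\kappa$ such that, with respect to some isometric embedding of $\bigoplus_\kappa \mathcal V_\kappa\otimes\mathbb C^{d_\kappa}$ into $\mathcal K$, where $\mathcal V_\kappa=\mathrm{span}\{v_{\theta'}:\kappa(\theta')=\kappa\}$, $$M_\theta=|v_\theta\rangle\langle v_\theta|\otimes I_{d_{\kappa(\theta)}}\qquad(\theta\in\Theta),$$ that is, $M_\theta=J_{\kappa(\theta)}\,(|v_\theta\rangle\langle v_\theta|\otimes I_{d_{\kappa(\theta)}})\,J_{\kappa(\theta)}^\dagger$ for isometries $J_\kappa:\mathcal V_\kappa\otimes\mathbb C^{d_\kappa}\to\mathcal K$ with mutually orthogonal ranges. -/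

import Mathlib

open scoped TensorProduct CStarAlgebra

noncomputable section

namespace ObsConv

/-- Two indices are adjacent when they are distinct and the product of the corresponding operators
is nonzero (in one order; for self-adjoint operators the two orders are equivalent). -/
def productGraph {Θ A : Type*} [Mul A] [Zero A] (L : Θ → A) : SimpleGraph Θ :=
  SimpleGraph.fromRel fun a b => L a * L b ≠ 0

/-- The index set of the connected components `κ` of the family `L`: two indices lie in the same
component iff they are joined by a chain along which consecutive products are nonzero. -/
abbrev Component {Θ A : Type*} [Mul A] [Zero A] (L : Θ → A) : Type _ :=
  (productGraph L).ConnectedComponent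

/-- The component containing `θ`. -/
def component {Θ A : Type*} [Mul A] [Zero A] (L : Θ → A) (θ : Θ) : Component L :=
  (productGraph L).connectedComponentMk θ

/-- Two families of vectors are unitarily equivalent if a unitary operator between the subspaces
they span maps one family to the other. -/
def UnitarilyEquivalent {Θ E G : Type*} [NormedAddCommGroup E] [InnerProductSpace ℂ E]
    [NormedAddCommGroup G] [InnerProductSpace ℂ G] (u : Θ → E) (v : Θ → G) : Prop :=
  ∃ W : Submodule.span ℂ (Set.range u) ≃ₗᵢ[ℂ] Submodule.span ℂ (Set.range v),
    ∀ θ, (W ⟨u θ, Submodule.subset_span (Set.mem_range_self θ)⟩ : G) = v θ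

/-- The span of the vectors `v θ` with `θ` in the component `κ` of the family `L`. -/
def blockSpan {Θ A G : Type*} [Mul A] [Zero A] [NormedAddCommGroup G]
    [InnerProductSpace ℂ G]
    (L : Θ → A) (v : Θ → G) (κ : Component L) : Submodule ℂ G :=
  Submodule.span ℂ (v '' {θ | component L θ = κ})

/-- The vector `v θ`, as an element of the span of its block. -/
def blockVec {Θ A G : Type*} [Mul A] [Zero A] [NormedAddCommGroup G]
    [InnerProductSpace ℂ G]
    (L : Θ → A) (v : Θ → G) (θ : Θ) : blockSpan L v (component L θ) :=
  ⟨v θ, Submodule.subset_span ⟨θ, rfl, rfl⟩⟩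

/-- The operator `|x⟩⟨x| ⊗ I_d` on `E ⊗ ℂ^d`. -/
def rankOneTensorId {E : Type*} [NormedAddCommGroup E] [InnerProductSpace ℂ E] (x : E) (d : ℕ) :
    (E ⊗[ℂ] EuclideanSpace ℂ (Fin d)) →ₗ[ℂ] (E ⊗[ℂ] EuclideanSpace ℂ (Fin d)) :=
  TensorProduct.map (InnerProductSpace.rankOne ℂ x x : E →L[ℂ] E).toLinearMap LinearMap.id

/-- The operator `J T J†` on `K`: the operator `T` transported to the range of the isometry `J`,
extended by zero to the orthogonal complement of that range. -/
def embedOp {F K : Type*} [NormedAddCommGroup F] [InnerProductSpace ℂ F] [FiniteDimensional ℂ F]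
    [NormedAddCommGroup K] [InnerProductSpace ℂ K] [FiniteDimensional ℂ K]
    (J : F →ₗᵢ[ℂ] K) (T : F →ₗ[ℂ] F) : K →ₗ[ℂ] K :=
  J.toLinearMap ∘ₗ T ∘ₗ LinearMap.adjoint J.toLinearMap

end ObsConv

end

/-!
If `L` is a rank-one operator `|u⟩⟨u|` and `M = Λ L` is a multiple of a projector of the same norm,
then `L² = ‖L‖ L` and `M² = ‖L‖ M`, so the Kadison–Schwarz inequality `(Λ L)² ≤ Λ (L²)` is an
equality and, by Choi's theorem, `L` lies in the multiplicative domain of `Λ`. The multiplicative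
domain is a `*`-algebra, so multiplying along a chain puts `|x⟩⟨y|` in it for all `x`, `y` in the
span of one component. For a unit vector `e` in that span, `x ⊗ r ↦ Λ(|x⟩⟨e|) r` is therefore an
isometry on `span ⊗ R`, where `R` is the range of the projector `Λ(|e⟩⟨e|)`. This gives the
isometries `J_κ`, and distinct components have orthogonal ranges because their spans are orthogonal.

Conversely, let `V_κ` be the isometry taking `v θ` to `u θ` on the component `κ`; the operators
`x ↦ J_κ (V_κ† x ⊗ eᵢ)` are Kraus operators of a suitable `Λ`.
-/

noncomputable section

namespace ObsConv

open InnerProductSpace (rankOne)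
open ContinuousLinearMap (adjoint)

section CStarMatrix

section

variable {A : Type*} [NonUnitalCStarAlgebra A] [PartialOrder A] [StarOrderedRing A]

-- `CStarAlgebra.nonneg_iff_eq_star_mul_self` does not find its instances on `CStarMatrix n n A`.
lemma exists_eq_star_mul_self_of_nonneg {a : A} (ha : 0 ≤ a) : ∃ b, a = star b * b :=
  CStarAlgebra.nonneg_iff_eq_star_mul_self.mp ha

lemma nonneg_of_forall_conjugate_eq_neg {a : A} (ha : IsSelfAdjoint a)
    (h : ∀ b r, star b * a * b = -(star r * r) → r = 0) : 0 ≤ a := by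
  rw [CStarAlgebra.nonneg_iff_isSelfAdjoint_and_negPart_eq_zero]
  refine ⟨ha, ?_⟩
  have hstar : star a⁻ = a⁻ := (CFC.negPart_nonneg a).isSelfAdjoint.star_eq
  have hconj : star a⁻ * a * a⁻ = -(a⁻ * a⁻ * a⁻) := by
    nth_rewrite 2 [← CFC.posPart_sub_negPart a ha]
    rw [hstar, mul_sub, CFC.negPart_mul_posPart, zero_sub, neg_mul]
  obtain ⟨r, hr⟩ := exists_eq_star_mul_self_of_nonneg
    ((CFC.negPart_nonneg a).isSelfAdjoint.conjugate_nonneg (CFC.negPart_nonneg a))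
  have hcube : a⁻ * a⁻ * a⁻ = 0 := by rw [hr, h _ r (hr ▸ hconj), mul_zero]
  have hsq : a⁻ * a⁻ = 0 := by
    rw [← CStarRing.star_mul_self_eq_zero_iff, star_mul, hstar, ← mul_assoc, hcube, zero_mul]
  rwa [← CStarRing.star_mul_self_eq_zero_iff, hstar]

lemma eq_zero_of_sum_star_mul_self_nonpos {ι : Type*} [Fintype ι] {a : ι → A}
    (ha : ∑ i, star (a i) * a i ≤ 0) : a = 0 := by
  have hterms := (Finset.sum_eq_zero_iff_of_nonneg fun i _ => star_mul_self_nonneg (a i)).mp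
    (ha.antisymm (Finset.sum_nonneg fun i _ => star_mul_self_nonneg (a i)))
  funext i
  exact (CStarRing.star_mul_self_eq_zero_iff _).mp (hterms i (Finset.mem_univ i))

end

variable {n A : Type*} [Fintype n] [NonUnitalCStarAlgebra A]

lemma mul_mul_apply (X M Y : CStarMatrix n n A) (i j : n) :
    (X * M * Y) i j = ∑ k, X i k * ∑ l, M k l * Y l j := by
  simp only [CStarMatrix.mul_apply, Finset.sum_mul, Finset.mul_sum, mul_assoc]
  exact Finset.sum_comm

lemma sum_star_mul_self_apply_mul (B : CStarMatrix n n A) (x : n → A) (i : n) :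
    ∑ j, (star B * B) i j * x j = ∑ k, star (B k i) * ∑ j, B k j * x j := by
  simp only [CStarMatrix.mul_apply, CStarMatrix.star_apply, Finset.sum_mul, Finset.mul_sum,
    mul_assoc]
  exact Finset.sum_comm

lemma quadraticForm_star_mul_self (B : CStarMatrix n n A) (x : n → A) :
    ∑ i, star (x i) * ∑ j, (star B * B) i j * x j =
      ∑ k, star (∑ j, B k j * x j) * ∑ j, B k j * x j := by
  calc ∑ i, star (x i) * ∑ j, (star B * B) i j * x j
      = ∑ i, ∑ k, star (x i) * (star (B k i) * ∑ j, B k j * x j) :=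
        Finset.sum_congr rfl fun i _ => by rw [sum_star_mul_self_apply_mul, Finset.mul_sum]
    _ = ∑ k, star (∑ j, B k j * x j) * ∑ j, B k j * x j := by
        rw [Finset.sum_comm]
        simp only [star_sum, star_mul, Finset.sum_mul, mul_assoc]

variable [PartialOrder A] [StarOrderedRing A]

lemma cstarMatrix_nonneg_of_quadraticForm_nonneg {M : CStarMatrix n n A} (hM : IsSelfAdjoint M)
    (h : ∀ x : n → A, 0 ≤ ∑ i, star (x i) * ∑ j, M i j * x j) : 0 ≤ M := by
  refine nonneg_of_forall_conjugate_eq_neg hM fun N R hNR => ?_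
  have hcol (j : n) : (fun k => R k j) = 0 := by
    refine eq_zero_of_sum_star_mul_self_nonpos ?_
    have hdiag : (star N * M * N) j j = -∑ k, star (R k j) * R k j := by
      rw [hNR]
      simp [CStarMatrix.mul_apply, CStarMatrix.star_apply]
    rw [mul_mul_apply] at hdiag
    exact neg_nonneg.mp (hdiag ▸ h fun i => N i j)
  ext k j
  exact congrFun (hcol j) k

lemma gramMatrix_nonneg (b : n → A) :
    0 ≤ CStarMatrix.ofMatrix (Matrix.of fun i j => star (b i) * b j) := by
  refine cstarMatrix_nonneg_of_quadraticForm_nonneg ?_ fun x => ?_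
  · ext i j
    simp [CStarMatrix.star_apply]
  · have : ∑ i, star (x i) * ∑ j, star (b i) * b j * x j =
        star (∑ i, b i * x i) * ∑ j, b j * x j := by
      simp only [star_sum, star_mul, Finset.sum_mul, Finset.mul_sum, mul_assoc]
      exact Finset.sum_comm
    exact this ▸ star_mul_self_nonneg _

lemma sum_mul_eq_zero_of_quadraticForm_nonpos {M : CStarMatrix n n A} (hM : 0 ≤ M) {c : n → A}
    (hc : ∑ i, star (c i) * ∑ j, M i j * c j ≤ 0) (i : n) : ∑ j, M i j * c j = 0 := by
  obtain ⟨B, rfl⟩ := exists_eq_star_mul_self_of_nonneg hM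
  have hBc := eq_zero_of_sum_star_mul_self_nonpos (quadraticForm_star_mul_self B c ▸ hc)
  rw [sum_star_mul_self_apply_mul]
  exact Finset.sum_eq_zero fun k _ => by rw [congrFun hBc k, Pi.zero_apply, mul_zero]

end CStarMatrix

section MultiplicativeDomain

lemma smul_isStarProjection_mul_self {A : Type*} [CStarAlgebra A] {c : ℝ} (hc : 0 ≤ c) {p : A}
    (hp : IsStarProjection p) :
    (c : ℂ) • p * (c : ℂ) • p = (‖(c : ℂ) • p‖ : ℂ) • (c : ℂ) • p := by
  have hp_norm : (‖p‖ : ℂ) • p = p := by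
    obtain rfl | hp0 := eq_or_ne p 0
    · rw [smul_zero]
    · have h := CStarRing.norm_star_mul_self (x := p)
      rw [hp.isSelfAdjoint.star_eq, hp.isIdempotentElem.eq] at h
      rw [(mul_eq_left₀ (norm_ne_zero_iff.mpr hp0)).mp h.symm, Complex.ofReal_one, one_smul]
  rw [smul_mul_smul_comm, hp.isIdempotentElem.eq, norm_smul, Complex.norm_real,
    Real.norm_of_nonneg hc, Complex.ofReal_mul, mul_smul, mul_smul, smul_comm (‖p‖ : ℂ), hp_norm]

variable {A B : Type*} [CStarAlgebra A] [PartialOrder A] [StarOrderedRing A]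
  [CStarAlgebra B] [PartialOrder B] [StarOrderedRing B]

-- The image under `φ` of the Gram matrix of `(x†, a, 1)` is positive, and its quadratic form at
-- `(0, 1, -φ a)` is nonpositive, so it kills this vector; the claim is the first entry.
lemma map_mul_of_map_star_mul_self_le (φ : A →CP B) (hφ : φ 1 ≤ 1) {a : A}
    (ha : φ (star a * a) ≤ star (φ a) * φ a) (x : A) : φ (x * a) = φ x * φ a := by
  have hM := φ.map_cstarMatrix_nonneg _ (gramMatrix_nonneg ![star x, a, 1])
  have hq := sum_mul_eq_zero_of_quadraticForm_nonpos hM (c := ![0, 1, -φ a]) ?_ 0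
  · simpa [Fin.sum_univ_three, CStarMatrix.map_apply, add_neg_eq_zero] using hq
  · have hconj : star (φ a) * φ 1 * φ a ≤ star (φ a) * φ a := by
      simpa using star_left_conjugate_le_conjugate hφ (φ a)
    calc ∑ i, star (![0, 1, -φ a] i) * ∑ j,
        (CStarMatrix.ofMatrix (Matrix.of fun i j =>
          star (![star x, a, 1] i) * ![star x, a, 1] j)).map φ i j * ![0, 1, -φ a] j
        = (φ (star a * a) - star (φ a) * φ a) +
            (star (φ a) * φ 1 * φ a - star (φ a) * φ a) := by
          simp only [CStarMatrix.map_apply, CStarMatrix.ofMatrix_apply, Matrix.of_apply,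
            Fin.sum_univ_three, Fin.isValue, Matrix.cons_val_zero, Matrix.cons_val_one,
            Matrix.cons_val, star_zero, star_one, star_neg, star_star, map_star φ a, zero_mul,
            mul_zero, one_mul, mul_one, neg_mul, mul_neg, zero_add]
          noncomm_ring
      _ ≤ 0 := add_nonpos (sub_nonpos.mpr ha) (sub_nonpos.mpr hconj)

/-- Choi's multiplicative domain of a completely positive map `φ`: the elements on which `φ` is
multiplicative from both sides. As `φ` need not be unital, it is encoded as a non-unital star
subalgebra. -/
def multiplicativeDomain (φ : A →CP B) : NonUnitalStarSubalgebra ℂ A where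
  carrier := {a | ∀ x, φ (x * a) = φ x * φ a ∧ φ (a * x) = φ a * φ x}
  add_mem' ha hb x := by
    simp only [mul_add, add_mul, map_add, (ha x).1, (ha x).2, (hb x).1, (hb x).2, and_self]
  zero_mem' x := by simp
  mul_mem' {a b} ha hb x := by
    constructor
    · rw [← mul_assoc, (hb _).1, (ha _).1, (hb _).1, mul_assoc]
    · rw [mul_assoc, (ha _).2, (hb _).2, (ha _).2, mul_assoc]
  smul_mem' c a ha x := by
    simp [(ha x).1, (ha x).2]
  star_mem' {a} ha x := by
    have hright := congrArg star (ha (star x)).1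
    have hleft := congrArg star (ha (star x)).2
    simp only [← map_star, star_mul, star_star] at hright hleft
    exact ⟨hleft, hright⟩

lemma mem_multiplicativeDomain_of_map_mul_self_le (φ : A →CP B) (hφ : φ 1 ≤ 1) {a : A}
    (ha : IsSelfAdjoint a) (hle : φ (a * a) ≤ φ a * φ a) : a ∈ multiplicativeDomain φ := by
  have hmul := map_mul_of_map_star_mul_self_le φ hφ (a := a)
    (by rwa [← map_star, ha.star_eq])
  refine fun x => ⟨hmul x, ?_⟩
  have h := congrArg star (hmul (star x))
  rwa [← map_star, star_mul, star_mul, star_star, ← map_star, ← map_star, star_star,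
    ha.star_eq] at h

lemma isStarProjection_map {φ : A →CP B} {p : A} (hp : IsStarProjection p)
    (hmem : p ∈ multiplicativeDomain φ) : IsStarProjection (φ p) where
  isIdempotentElem := by rw [IsIdempotentElem, ← (hmem p).1, hp.isIdempotentElem.eq]
  isSelfAdjoint := by rw [IsSelfAdjoint, ← map_star, hp.isSelfAdjoint.star_eq]

lemma mem_multiplicativeDomain_of_norm_eq (φ : A →CP B) (hφ : φ 1 ≤ 1) {a : A}
    (ha : IsSelfAdjoint a) (hsq : a * a = (‖a‖ : ℂ) • a)
    (hφsq : φ a * φ a = (‖φ a‖ : ℂ) • φ a) (hnorm : ‖a‖ = ‖φ a‖) :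
    a ∈ multiplicativeDomain φ :=
  mem_multiplicativeDomain_of_map_mul_self_le φ hφ ha (by rw [hsq, map_smul, hφsq, hnorm])

end MultiplicativeDomain

section RankOne

lemma rankOne_mul_rankOne {𝕜 H : Type*} [RCLike 𝕜] [NormedAddCommGroup H] [InnerProductSpace 𝕜 H]
    (x y z w : H) :
    (rankOne 𝕜 x y : H →L[𝕜] H) * rankOne 𝕜 z w = (inner 𝕜 y z : 𝕜) • rankOne 𝕜 x w := by
  rw [ContinuousLinearMap.mul_def, InnerProductSpace.rankOne_comp_rankOne]

variable {H : Type*} [NormedAddCommGroup H] [InnerProductSpace ℂ H]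

lemma rankOne_self_mul_self (u : H) : (rankOne ℂ u u : H →L[ℂ] H) * rankOne ℂ u u =
    (‖(rankOne ℂ u u : H →L[ℂ] H)‖ : ℂ) • rankOne ℂ u u := by
  rw [rankOne_mul_rankOne, inner_self_eq_norm_sq_to_K, InnerProductSpace.norm_rankOne,
    Complex.ofReal_mul, sq]
  rfl

variable {Θ : Type*} {u : Θ → H} {L : Θ → H →L[ℂ] H}

lemma mul_ne_zero_iff_inner_ne_zero (hL : ∀ θ, L θ = rankOne ℂ (u θ) (u θ)) {a b : Θ} :
    L a * L b ≠ 0 ↔ (inner ℂ (u a) (u b) : ℂ) ≠ 0 := by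
  rw [hL, hL, rankOne_mul_rankOne]
  simp only [ne_eq, smul_eq_zero, InnerProductSpace.rankOne_eq_zero, not_or]
  refine ⟨And.left, fun h => ⟨h, ?_, ?_⟩⟩ <;> rintro h0 <;> simp [h0] at h

lemma component_eq_of_inner_ne_zero (hL : ∀ θ, L θ = rankOne ℂ (u θ) (u θ)) {a b : Θ}
    (hab : (inner ℂ (u a) (u b) : ℂ) ≠ 0) : component L a = component L b := by
  obtain rfl | hne := eq_or_ne a b
  · rfl
  · exact SimpleGraph.ConnectedComponent.sound (SimpleGraph.Adj.reachable
      ((SimpleGraph.fromRel_adj _ _ _).mpr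
        ⟨hne, Or.inl ((mul_ne_zero_iff_inner_ne_zero hL).mpr hab)⟩))

lemma isOrtho_blockSpan {G : Type*} [NormedAddCommGroup G] [InnerProductSpace ℂ G]
    (hL : ∀ θ, L θ = rankOne ℂ (u θ) (u θ)) {v : Θ → G}
    (huv : ∀ a b, inner ℂ (v a) (v b) = (inner ℂ (u a) (u b) : ℂ)) {κ κ' : Component L}
    (hκ : κ ≠ κ') : blockSpan L v κ ⟂ blockSpan L v κ' := by
  refine Submodule.isOrtho_span.mpr ?_
  rintro _ ⟨a, rfl, rfl⟩ _ ⟨b, rfl, rfl⟩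
  by_contra h
  exact hκ (component_eq_of_inner_ne_zero hL (huv a b ▸ h))

variable [CompleteSpace H] {S : NonUnitalStarSubalgebra ℂ (H →L[ℂ] H)}

lemma rankOne_mem_of_mem_span {s t : Set H}
    (h : ∀ x ∈ s, ∀ y ∈ t, rankOne ℂ x y ∈ S) {x y : H} (hx : x ∈ Submodule.span ℂ s)
    (hy : y ∈ Submodule.span ℂ t) : rankOne ℂ x y ∈ S := by
  induction hx, hy using Submodule.span_induction₂ with
  | mem_mem x y hx hy => exact h x hx y hy
  | zero_left | zero_right => simp
  | add_left x y z _ _ _ hx hy => simpa using add_mem hx hy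
  | add_right x y z _ _ _ hx hy => simpa using add_mem hx hy
  | smul_left c x y _ _ hxy | smul_right c x y _ _ hxy => simpa using SMulMemClass.smul_mem _ hxy

lemma rankOne_mem_of_reachable (hL : ∀ θ, L θ = rankOne ℂ (u θ) (u θ)) (hS : ∀ θ, L θ ∈ S)
    {a b : Θ} (hab : (productGraph L).Reachable a b) : rankOne ℂ (u a) (u b) ∈ S := by
  rw [SimpleGraph.reachable_iff_reflTransGen] at hab
  induction hab with
  | refl => exact hL a ▸ hS a
  | @tail b c _ hbc ih =>
    have hin : (inner ℂ (u b) (u c) : ℂ) ≠ 0 := by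
      rcases ((SimpleGraph.fromRel_adj _ _ _).mp hbc).2 with h | h
      · exact (mul_ne_zero_iff_inner_ne_zero hL).mp h
      · exact mt inner_eq_zero_symm.mp ((mul_ne_zero_iff_inner_ne_zero hL).mp h)
    have hmul := SMulMemClass.smul_mem (inner ℂ (u b) (u c) : ℂ)⁻¹ (mul_mem ih (hS c))
    rwa [hL, rankOne_mul_rankOne, inv_smul_smul₀ hin] at hmul

lemma rankOne_mem_of_mem_blockSpan (hL : ∀ θ, L θ = rankOne ℂ (u θ) (u θ)) (hS : ∀ θ, L θ ∈ S)
    {κ : Component L} {x y : H} (hx : x ∈ blockSpan L u κ) (hy : y ∈ blockSpan L u κ) :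
    rankOne ℂ x y ∈ S := by
  refine rankOne_mem_of_mem_span ?_ hx hy
  rintro _ ⟨a, rfl, rfl⟩ _ ⟨b, hb, rfl⟩
  exact rankOne_mem_of_reachable hL hS (SimpleGraph.ConnectedComponent.exact (Eq.symm hb))

end RankOne

section TensorIsometry

variable {𝕜 E F K : Type*} [RCLike 𝕜] [NormedAddCommGroup E] [InnerProductSpace 𝕜 E]
  [NormedAddCommGroup F] [InnerProductSpace 𝕜 F] [NormedAddCommGroup K] [InnerProductSpace 𝕜 K]

/-- The isometry `E ⊗ F → K` induced by a bilinear map that multiplies inner products. -/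
def tensorIsometry (B : E →ₗ[𝕜] F →ₗ[𝕜] K)
    (hB : ∀ x c y c', inner 𝕜 (B x c) (B y c') = (inner 𝕜 x y * inner 𝕜 c c' : 𝕜)) :
    E ⊗[𝕜] F →ₗᵢ[𝕜] K :=
  (TensorProduct.lift B).isometryOfInner fun z w => by
    induction z using TensorProduct.induction_on with
    | zero => simp
    | add z₁ z₂ h₁ h₂ => rw [map_add, inner_add_left, h₁, h₂, inner_add_left]
    | tmul x c =>
      induction w using TensorProduct.induction_on with
      | zero => simp
      | add w₁ w₂ h₁ h₂ => rw [map_add, inner_add_right, h₁, h₂, inner_add_right]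
      | tmul y c' => simp [hB]

lemma tensorIsometry_tmul (B : E →ₗ[𝕜] F →ₗ[𝕜] K)
    (hB : ∀ x c y c', inner 𝕜 (B x c) (B y c') = (inner 𝕜 x y * inner 𝕜 c c' : 𝕜))
    (x : E) (c : F) : tensorIsometry B hB (x ⊗ₜ c) = B x c :=
  TensorProduct.lift.tmul x c

lemma orthogonalFamily_of_inner_tmul_eq_zero {ι : Type*} {E F : ι → Type*}
    [∀ i, NormedAddCommGroup (E i)] [∀ i, InnerProductSpace 𝕜 (E i)]
    [∀ i, NormedAddCommGroup (F i)] [∀ i, InnerProductSpace 𝕜 (F i)]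
    {J : ∀ i, E i ⊗[𝕜] F i →ₗᵢ[𝕜] K}
    (hJ : ∀ i j, i ≠ j → ∀ x c y c', (inner 𝕜 (J i (x ⊗ₜ c)) (J j (y ⊗ₜ c')) : 𝕜) = 0) :
    OrthogonalFamily 𝕜 (fun i => E i ⊗[𝕜] F i) J := by
  intro i j hij z w
  induction z using TensorProduct.induction_on with
  | zero => simp
  | add z₁ z₂ h₁ h₂ => rw [map_add, inner_add_left, h₁, h₂, add_zero]
  | tmul x c =>
    induction w using TensorProduct.induction_on with
    | zero => simp
    | add w₁ w₂ h₁ h₂ => rw [map_add, inner_add_right, h₁, h₂, add_zero]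
    | tmul y c' => exact hJ i j hij x c y c'

end TensorIsometry

section Amplification

variable {E K : Type*} [NormedAddCommGroup E] [InnerProductSpace ℂ E]
  [NormedAddCommGroup K] [InnerProductSpace ℂ K] {d : ℕ}

/-- The isometry `x ↦ J (x ⊗ eᵢ)`, where `eᵢ` is the `i`-th standard basis vector of `ℂᵈ`. -/
def slice (J : E ⊗[ℂ] EuclideanSpace ℂ (Fin d) →ₗᵢ[ℂ] K) (i : Fin d) : E →ₗᵢ[ℂ] K where
  toFun x := J (x ⊗ₜ EuclideanSpace.single i 1)
  map_add' x y := by rw [TensorProduct.add_tmul, map_add]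
  map_smul' c x := by rw [← TensorProduct.smul_tmul', map_smul, RingHom.id_apply]
  norm_map' x := by simp

lemma slice_apply (J : E ⊗[ℂ] EuclideanSpace ℂ (Fin d) →ₗᵢ[ℂ] K) (i : Fin d) (x : E) :
    slice J i x = J (x ⊗ₜ EuclideanSpace.single i 1) := rfl

lemma orthogonalFamily_slice {ι : Type*} {E : ι → Type*} [∀ i, NormedAddCommGroup (E i)]
    [∀ i, InnerProductSpace ℂ (E i)] {d : ι → ℕ}
    {J : ∀ i, E i ⊗[ℂ] EuclideanSpace ℂ (Fin (d i)) →ₗᵢ[ℂ] K}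
    (hJ : OrthogonalFamily ℂ (fun i => E i ⊗[ℂ] EuclideanSpace ℂ (Fin (d i))) J) :
    OrthogonalFamily ℂ (fun p : Σ i, Fin (d i) => E p.1) fun p => slice (J p.1) p.2 := by
  rintro ⟨i, k⟩ ⟨j, l⟩ hne x y
  simp only [slice_apply]
  obtain rfl | hij := eq_or_ne i j
  · have hkl : k ≠ l := fun h => hne (by rw [h])
    simp [EuclideanSpace.inner_single_left, hkl]
  · exact hJ hij _ _

/-- The operator `J (|x⟩⟨x| ⊗ I_d) J†` on `K`, written as a sum of rank-one operators so that
neither `E` nor `K` has to be finite-dimensional. -/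
def amplification (J : E ⊗[ℂ] EuclideanSpace ℂ (Fin d) →ₗᵢ[ℂ] K) (x : E) : K →L[ℂ] K :=
  ∑ i, rankOne ℂ (slice J i x) (slice J i x)

lemma amplification_zero (J : E ⊗[ℂ] EuclideanSpace ℂ (Fin d) →ₗᵢ[ℂ] K) :
    amplification J 0 = 0 := by
  simp [amplification]

lemma sum_inner_tmul_single_smul (x : E) (z : E ⊗[ℂ] EuclideanSpace ℂ (Fin d)) :
    ∑ i, (inner ℂ (x ⊗ₜ EuclideanSpace.single i 1) z : ℂ) •
      (x ⊗ₜ[ℂ] EuclideanSpace.single i (1 : ℂ)) = rankOneTensorId x d z := by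
  induction z using TensorProduct.induction_on with
  | zero => simp
  | add a b ha hb => simp only [map_add, ← ha, ← hb, inner_add_right, add_smul,
      Finset.sum_add_distrib]
  | tmul y c =>
    have hc : ∑ i, c i • EuclideanSpace.single i (1 : ℂ) = c := by
      ext j
      simp [Finset.sum_apply, Pi.single_apply]
    simp only [TensorProduct.inner_tmul, mul_smul, ← Finset.smul_sum,
      EuclideanSpace.inner_single_left, map_one, one_mul, ← TensorProduct.tmul_smul,
      ← TensorProduct.tmul_sum, hc]
    simp [rankOneTensorId, TensorProduct.smul_tmul']

lemma amplification_apply_tmul (J : E ⊗[ℂ] EuclideanSpace ℂ (Fin d) →ₗᵢ[ℂ] K) (x : E)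
    (c : EuclideanSpace ℂ (Fin d)) :
    amplification J x (J (x ⊗ₜ c)) = (inner ℂ x x : ℂ) • J (x ⊗ₜ c) := by
  simp only [amplification, sum_apply, InnerProductSpace.rankOne_apply,
    slice_apply, LinearIsometry.inner_map_map, ← map_smul, ← map_sum, sum_inner_tmul_single_smul]
  simp [rankOneTensorId, TensorProduct.smul_tmul']

lemma embedOp_rankOneTensorId [FiniteDimensional ℂ E] [FiniteDimensional ℂ K]
    (J : E ⊗[ℂ] EuclideanSpace ℂ (Fin d) →ₗᵢ[ℂ] K) (x : E) :
    embedOp J (rankOneTensorId x d) = (amplification J x).toLinearMap := by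
  ext k
  simp only [embedOp, LinearMap.comp_apply, ← sum_inner_tmul_single_smul, map_sum, map_smul,
    LinearMap.adjoint_inner_right]
  simp [amplification, slice_apply]

lemma amplification_comp_rTensor {G : Type*} [NormedAddCommGroup G] [InnerProductSpace ℂ G]
    (J : E ⊗[ℂ] EuclideanSpace ℂ (Fin d) →ₗᵢ[ℂ] K) (W : G →ₗᵢ[ℂ] E) (x : G) :
    amplification (J.comp (W.rTensor (EuclideanSpace ℂ (Fin d)))) x = amplification J (W x) := by
  simp [amplification, slice_apply]

end Amplification

section RankOneImage

variable {H K : Type*} [NormedAddCommGroup H] [InnerProductSpace ℂ H] [CompleteSpace H]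
  [NormedAddCommGroup K] [InnerProductSpace ℂ K] [CompleteSpace K]
  {φ : (H →L[ℂ] H) →CP (K →L[ℂ] K)}

lemma star_map_rankOne (x y : H) : star (φ (rankOne ℂ x y)) = φ (rankOne ℂ y x) := by
  rw [← map_star, ContinuousLinearMap.star_eq_adjoint, InnerProductSpace.adjoint_rankOne]

lemma inner_map_rankOne_apply (x e : H) {y e' : H} (hy : rankOne ℂ y e' ∈ multiplicativeDomain φ)
    (r s : K) : (inner ℂ (φ (rankOne ℂ x e) r) (φ (rankOne ℂ y e') s) : ℂ) =
      inner ℂ x y * inner ℂ r (φ (rankOne ℂ e e') s) := by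
  rw [← ContinuousLinearMap.adjoint_inner_right, ← ContinuousLinearMap.star_eq_adjoint,
    star_map_rankOne, ← mul_apply_eq_comp, ← (hy _).1, rankOne_mul_rankOne, map_smul, smul_apply,
    inner_smul_right]

lemma sum_rankOne_apply_orthonormalBasis {ι : Type*} [Fintype ι] {R : Submodule ℂ K}
    [R.HasOrthogonalProjection] (b : OrthonormalBasis ι ℂ R) (T : K →L[ℂ] K) :
    ∑ i, rankOne ℂ (T (b i)) (T (b i)) = T * R.starProjection * star T := by
  rw [b.starProjection_eq_sum_rankOne, Finset.mul_sum, Finset.sum_mul]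
  refine Finset.sum_congr rfl fun i _ => ?_
  simp only [ContinuousLinearMap.mul_def, ContinuousLinearMap.star_eq_adjoint,
    InnerProductSpace.comp_rankOne, InnerProductSpace.rankOne_comp,
    ContinuousLinearMap.adjoint_adjoint]

lemma exists_amplification_of_ne_zero [FiniteDimensional ℂ K] {V : Submodule ℂ H}
    (hV : ∀ x ∈ V, ∀ y ∈ V, rankOne ℂ x y ∈ multiplicativeDomain φ) {e : H} (heV : e ∈ V)
    (he : ‖e‖ = 1) (hφe : φ (rankOne ℂ e e) ≠ 0) :
    ∃ d, 0 < d ∧ ∃ J : V ⊗[ℂ] EuclideanSpace ℂ (Fin d) →ₗᵢ[ℂ] K,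
      ∀ x : V, φ (rankOne ℂ (x : H) (x : H)) = amplification J x := by
  have hP : IsStarProjection (φ (rankOne ℂ e e)) := isStarProjection_map
    (InnerProductSpace.isStarProjection_rankOne_self he) (hV e heV e heV)
  set P := φ (rankOne ℂ e e) with hPdef
  obtain ⟨R, _, hR⟩ := isStarProjection_iff_eq_starProjection.mp hP
  let b := stdOrthonormalBasis ℂ R
  have hPb (r : R) : P r = r := by
    rw [hR]; exact Submodule.starProjection_eq_self_iff.mpr r.2
  let B : V →ₗ[ℂ] EuclideanSpace ℂ (Fin (Module.finrank ℂ R)) →ₗ[ℂ] K :=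
    LinearMap.mk₂ ℂ (fun x c => φ (rankOne ℂ (x : H) e) (b.repr.symm c))
      (by simp) (by simp) (by simp) (by simp)
  have hB (x c y c') : inner ℂ (B x c) (B y c') = (inner ℂ x y * inner ℂ c c' : ℂ) := by
    simp only [B, LinearMap.mk₂_apply]
    rw [inner_map_rankOne_apply _ _ (hV _ y.2 _ heV), ← hPdef, hPb, Submodule.coe_inner,
      ← Submodule.coe_inner R, LinearIsometryEquiv.inner_map_map]
  refine ⟨Module.finrank ℂ R, ?_, tensorIsometry B hB, fun x => ?_⟩
  · rw [Module.finrank_pos_iff, Submodule.nontrivial_iff_ne_bot]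
    rintro rfl
    exact hφe (by simpa using hR)
  · have hslice (i) : slice (tensorIsometry B hB) i x = φ (rankOne ℂ (x : H) e) (b i) := by
      rw [slice_apply, tensorIsometry_tmul]
      simp [B]
    have hee : (inner ℂ e e : ℂ) = 1 := inner_self_eq_one_of_norm_eq_one he
    calc φ (rankOne ℂ (x : H) (x : H))
        = φ (rankOne ℂ (x : H) e * rankOne ℂ e e * rankOne ℂ e (x : H)) := by
          simp only [rankOne_mul_rankOne, hee, one_smul]
      _ = φ (rankOne ℂ (x : H) e) * P * star (φ (rankOne ℂ (x : H) e)) := by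
          rw [(hV e heV x x.2 _).1, (hV e heV e heV _).1, star_map_rankOne]
      _ = amplification (tensorIsometry B hB) x := by
          simp only [amplification, hslice, sum_rankOne_apply_orthonormalBasis, hR]

lemma exists_amplification [FiniteDimensional ℂ K] {V : Submodule ℂ H}
    (hV : ∀ x ∈ V, ∀ y ∈ V, rankOne ℂ x y ∈ multiplicativeDomain φ)
    (hφ : V ≠ ⊥ → ∃ u ∈ V, φ (rankOne ℂ u u) ≠ 0) :
    ∃ d, 0 < d ∧ ∃ J : V ⊗[ℂ] EuclideanSpace ℂ (Fin d) →ₗᵢ[ℂ] K,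
      ∀ x : V, φ (rankOne ℂ (x : H) (x : H)) = amplification J x := by
  by_cases hbot : V = ⊥
  · have hzero (x : V) : x = 0 := Subtype.ext ((Submodule.mem_bot ℂ).mp (hbot ▸ x.2))
    exact ⟨1, one_pos, tensorIsometry 0 fun x c y c' => by simp [hzero x],
      fun x => by simp [hzero x, amplification_zero]⟩
  · obtain ⟨u, hu, hφu⟩ := hφ hbot
    have hu0 : u ≠ 0 := by
      rintro rfl
      simp at hφu
    refine exists_amplification_of_ne_zero hV (V.smul_mem (‖u‖⁻¹ : ℂ) hu)
      (norm_smul_inv_norm hu0) ?_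
    simpa [hu0] using hφu

lemma inner_apply_tmul_eq_zero {V V' : Submodule ℂ H} (hVV' : V ⟂ V')
    (hV' : ∀ y ∈ V', rankOne ℂ y y ∈ multiplicativeDomain φ) {d d' : ℕ}
    {J : V ⊗[ℂ] EuclideanSpace ℂ (Fin d) →ₗᵢ[ℂ] K}
    {J' : V' ⊗[ℂ] EuclideanSpace ℂ (Fin d') →ₗᵢ[ℂ] K}
    (hJ : ∀ x : V, φ (rankOne ℂ (x : H) (x : H)) = amplification J x)
    (hJ' : ∀ x : V', φ (rankOne ℂ (x : H) (x : H)) = amplification J' x)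
    (x : V) (c : EuclideanSpace ℂ (Fin d)) (y : V') (c' : EuclideanSpace ℂ (Fin d')) :
    (inner ℂ (J (x ⊗ₜ c)) (J' (y ⊗ₜ c')) : ℂ) = 0 := by
  have h := inner_map_rankOne_apply (φ := φ) (x : H) x (hV' y y.2) (J (x ⊗ₜ c)) (J' (y ⊗ₜ c'))
  rw [hVV'.inner_eq x.2 y.2, zero_mul, hJ, hJ', amplification_apply_tmul,
    amplification_apply_tmul, inner_smul_left, inner_smul_right] at h
  simp only [mul_eq_zero, map_eq_zero, inner_self_eq_zero] at h
  obtain rfl | rfl | h := h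
  · rw [TensorProduct.zero_tmul, LinearIsometry.map_zero, inner_zero_left]
  · rw [TensorProduct.zero_tmul, LinearIsometry.map_zero, inner_zero_right]
  · exact h

lemma exists_orthogonalFamily_amplification [FiniteDimensional ℂ K] {Θ : Type*} {u : Θ → H}
    {L : Θ → H →L[ℂ] H} (hL : ∀ θ, L θ = rankOne ℂ (u θ) (u θ))
    (hmem : ∀ θ, L θ ∈ multiplicativeDomain φ) (hφ : ∀ θ, L θ ≠ 0 → φ (L θ) ≠ 0) :
    ∃ (d : Component L → ℕ)
      (J : ∀ κ, blockSpan L u κ ⊗[ℂ] EuclideanSpace ℂ (Fin (d κ)) →ₗᵢ[ℂ] K),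
      (∀ κ, 0 < d κ) ∧
      OrthogonalFamily ℂ (fun κ => blockSpan L u κ ⊗[ℂ] EuclideanSpace ℂ (Fin (d κ))) J ∧
      ∀ κ (x : blockSpan L u κ), φ (rankOne ℂ (x : H) (x : H)) = amplification (J κ) x := by
  have hV (κ : Component L) (x : H) (hx : x ∈ blockSpan L u κ) (y : H)
      (hy : y ∈ blockSpan L u κ) : rankOne ℂ x y ∈ multiplicativeDomain φ :=
    rankOne_mem_of_mem_blockSpan hL hmem hx hy
  have hne (κ : Component L) (hκ : blockSpan L u κ ≠ ⊥) :
      ∃ x ∈ blockSpan L u κ, φ (rankOne ℂ x x) ≠ 0 := by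
    obtain ⟨_, ⟨θ, hθ, rfl⟩, hu⟩ : ∃ x ∈ u '' {θ | component L θ = κ}, x ≠ 0 := by
      simpa only [blockSpan, ne_eq, Submodule.span_eq_bot, not_forall, exists_prop] using hκ
    refine ⟨u θ, Submodule.subset_span ⟨θ, hθ, rfl⟩, hL θ ▸ hφ θ ?_⟩
    rw [hL]
    exact InnerProductSpace.rankOne_ne_zero hu hu
  choose d hd J hJ using fun κ => exists_amplification (hV κ) (hne κ)
  exact ⟨d, J, hd, orthogonalFamily_of_inner_tmul_eq_zero fun κ κ' hκ =>
    inner_apply_tmul_eq_zero (isOrtho_blockSpan hL (fun _ _ => rfl) hκ)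
      (fun y hy => hV κ' y hy y hy) (hJ κ) (hJ κ'), hJ⟩

end RankOneImage

section UnitaryEquivalence

variable {Θ A H G : Type*} [Mul A] [Zero A] [NormedAddCommGroup H] [InnerProductSpace ℂ H]
  [NormedAddCommGroup G] [InnerProductSpace ℂ G] {u : Θ → H} {v : Θ → G}

lemma exists_unitarilyEquivalent_euclideanSpace (u : Θ → H)
    [FiniteDimensional ℂ (Submodule.span ℂ (Set.range u))] :
    ∃ (n : ℕ) (v : Θ → EuclideanSpace ℂ (Fin n)), UnitarilyEquivalent u v := by
  let e := (stdOrthonormalBasis ℂ (Submodule.span ℂ (Set.range u))).repr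
  let w (θ : Θ) : Submodule.span ℂ (Set.range u) := ⟨u θ, Submodule.subset_span ⟨θ, rfl⟩⟩
  have hspan : Submodule.span ℂ (Set.range (e ∘ w)) = ⊤ := by
    have hw : Submodule.span ℂ (Set.range w) = ⊤ := by
      refine Submodule.map_injective_of_injective (Submodule.subtype_injective _) ?_
      rw [Submodule.map_span, ← Set.range_comp, Submodule.map_subtype_top]
      rfl
    have hew : e '' Set.range w = e.toLinearEquiv.toLinearMap '' Set.range w := rfl
    rw [Set.range_comp, hew, Submodule.span_image, hw, Submodule.map_top, LinearEquiv.range]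
  exact ⟨_, e ∘ w, e.trans (LinearIsometryEquiv.ofTop _ _ hspan).symm, fun _ => rfl⟩

lemma inner_eq_of_unitarilyEquivalent (h : UnitarilyEquivalent u v) (a b : Θ) :
    inner ℂ (v a) (v b) = (inner ℂ (u a) (u b) : ℂ) := by
  obtain ⟨W, hW⟩ := h
  rw [← hW, ← hW, ← Submodule.coe_inner, LinearIsometryEquiv.inner_map_map, Submodule.coe_inner]

lemma exists_blockIsometry (L : Θ → A) (h : UnitarilyEquivalent u v) :
    ∃ W : ∀ κ, blockSpan L v κ →ₗᵢ[ℂ] blockSpan L u κ,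
      ∀ θ, W (component L θ) (blockVec L v θ) = blockVec L u θ := by
  obtain ⟨W, hW⟩ := h
  have hle (κ : Component L) : blockSpan L v κ ≤ Submodule.span ℂ (Set.range v) :=
    Submodule.span_mono (Set.image_subset_range _ _)
  let S : Submodule.span ℂ (Set.range v) →ₗ[ℂ] H :=
    Submodule.subtype _ ∘ₗ W.symm.toLinearEquiv.toLinearMap
  have hS (θ : Θ) : S ⟨v θ, Submodule.subset_span (Set.mem_range_self θ)⟩ = u θ := by
    have : W.symm ⟨v θ, Submodule.subset_span (Set.mem_range_self θ)⟩ =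
        ⟨u θ, Submodule.subset_span (Set.mem_range_self θ)⟩ := by
      rw [LinearIsometryEquiv.symm_apply_eq]
      exact Subtype.ext (hW θ).symm
    exact congrArg Subtype.val this
  have hblock (κ : Component L) :
      blockSpan L v κ ≤ ((blockSpan L u κ).comap S).map (Submodule.subtype _) := by
    refine Submodule.span_le.mpr ?_
    rintro _ ⟨θ, hθ, rfl⟩
    exact ⟨_, Submodule.subset_span ⟨θ, hθ, (hS θ).symm⟩, rfl⟩
  have hmem (κ : Component L) (x : blockSpan L v κ) :
      S (Submodule.inclusion (hle κ) x) ∈ blockSpan L u κ := by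
    obtain ⟨y, hy, hyx⟩ := hblock κ x.2
    rwa [show Submodule.inclusion (hle κ) x = y from Subtype.ext hyx.symm]
  exact ⟨fun κ =>
    { toLinearMap := (S ∘ₗ Submodule.inclusion (hle κ)).codRestrict (blockSpan L u κ) (hmem κ)
      norm_map' := fun _ => W.symm.norm_map _ }, fun θ => Subtype.ext (hS θ)⟩

end UnitaryEquivalence

lemma finiteDimensional_iSup_of_orthogonalFamily {𝕜 H K ι : Type*} [RCLike 𝕜]
    [NormedAddCommGroup H] [InnerProductSpace 𝕜 H] [NormedAddCommGroup K] [InnerProductSpace 𝕜 K]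
    [FiniteDimensional 𝕜 K] {V : ι → Submodule 𝕜 H} {B : ∀ i, V i →ₗᵢ[𝕜] K}
    (hB : OrthogonalFamily 𝕜 (fun i => V i) B) : FiniteDimensional 𝕜 ↥(⨆ i, V i) := by
  classical
  let S : (Π₀ i, V i) →ₗ[𝕜] K := DFinsupp.lsum 𝕜 fun i => (B i).toLinearMap
  have hS : Function.Injective S := by
    refine (injective_iff_map_eq_zero S).mpr fun x hx => DFinsupp.ext fun i => ?_
    have hi : inner 𝕜 (B i (x i)) (S x) = (inner 𝕜 (x i) (x i) : 𝕜) := by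
      simpa only [S, DFinsupp.lsum_apply_apply, DFinsupp.sumAddHom_apply] using!
        hB.inner_right_dfinsupp x i (x i)
    rwa [hx, inner_zero_right, eq_comm, inner_self_eq_zero] at hi
  have := FiniteDimensional.of_injective S hS
  rw [Submodule.iSup_eq_range_dfinsupp_lsum]
  infer_instance

lemma iSup_blockSpan {Θ A H : Type*} [Mul A] [Zero A] [NormedAddCommGroup H]
    [InnerProductSpace ℂ H] (L : Θ → A) (u : Θ → H) :
    ⨆ κ, blockSpan L u κ = Submodule.span ℂ (Set.range u) := by
  simp only [blockSpan]
  rw [← Submodule.span_iUnion, ← Set.image_iUnion]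
  congr 1
  rw [Set.iUnion_eq_univ_iff.mpr fun θ => ⟨component L θ, rfl⟩, Set.image_univ]

section Necessity

variable {Θ H K : Type*} [NormedAddCommGroup H] [InnerProductSpace ℂ H] [CompleteSpace H]
  [NormedAddCommGroup K] [InnerProductSpace ℂ K] [CompleteSpace K]
  {φ : (H →L[ℂ] H) →CP (K →L[ℂ] K)} {u : Θ → H} {L : Θ → H →L[ℂ] H}

lemma exists_embedOp_of_mem_multiplicativeDomain [FiniteDimensional ℂ K]
    (hL : ∀ θ, L θ = rankOne ℂ (u θ) (u θ)) (hmem : ∀ θ, L θ ∈ multiplicativeDomain φ)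
    (hφ : ∀ θ, L θ ≠ 0 → φ (L θ) ≠ 0) :
    ∃ (n : ℕ) (v : Θ → EuclideanSpace ℂ (Fin n)) (d : Component L → ℕ)
      (J : ∀ κ, blockSpan L v κ ⊗[ℂ] EuclideanSpace ℂ (Fin (d κ)) →ₗᵢ[ℂ] K),
      UnitarilyEquivalent u v ∧ (∀ κ, 0 < d κ) ∧
      OrthogonalFamily ℂ (fun κ => blockSpan L v κ ⊗[ℂ] EuclideanSpace ℂ (Fin (d κ))) J ∧
      ∀ θ, (φ (L θ)).toLinearMap = embedOp (J (component L θ))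
        (rankOneTensorId (blockVec L v θ) (d (component L θ))) := by
  obtain ⟨d, J, hd, hJ, hφJ⟩ := exists_orthogonalFamily_amplification hL hmem hφ
  have hfin : FiniteDimensional ℂ (Submodule.span ℂ (Set.range u)) := by
    rw [← iSup_blockSpan L u]
    exact finiteDimensional_iSup_of_orthogonalFamily ((orthogonalFamily_slice hJ).comp
      (f := fun κ => ⟨κ, ⟨0, hd κ⟩⟩) fun _ _ h => congrArg Sigma.fst h)
  obtain ⟨n, v, huv⟩ := exists_unitarilyEquivalent_euclideanSpace u
  obtain ⟨W, hW⟩ := exists_blockIsometry L huv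
  refine ⟨n, v, d, fun κ => (J κ).comp ((W κ).rTensor _), huv, hd,
    fun κ κ' hκ _ _ => hJ hκ _ _, fun θ => ?_⟩
  rw [embedOp_rankOneTensorId, amplification_comp_rTensor, hW, ← hφJ, hL]
  rfl

lemma rankOne_self_mem_multiplicativeDomain (hφ : φ 1 ≤ 1) {w : H}
    (hw : ∃ (c : ℝ) (P : K →L[ℂ] K), 0 ≤ c ∧ IsStarProjection P ∧
      φ (rankOne ℂ w w) = (c : ℂ) • P)
    (hnorm : ‖(rankOne ℂ w w : H →L[ℂ] H)‖ = ‖φ (rankOne ℂ w w)‖) :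
    rankOne ℂ w w ∈ multiplicativeDomain φ := by
  obtain ⟨c, P, hc, hP, hwP⟩ := hw
  refine mem_multiplicativeDomain_of_norm_eq φ hφ (InnerProductSpace.adjoint_rankOne w w)
    (rankOne_self_mul_self w) ?_ hnorm
  rw [hwP, smul_isStarProjection_mul_self hc hP]

end Necessity

section Kraus

variable {H K : Type*} [NormedAddCommGroup H] [InnerProductSpace ℂ H] [CompleteSpace H]
  [NormedAddCommGroup K] [InnerProductSpace ℂ K] [CompleteSpace K]

lemma map_conj_nonneg {n : Type*} [Fintype n] (T : H →L[ℂ] K) {M : CStarMatrix n n (H →L[ℂ] H)}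
    (hM : 0 ≤ M) : 0 ≤ M.map fun x => T ∘L x ∘L adjoint T := by
  obtain ⟨B, rfl⟩ := exists_eq_star_mul_self_of_nonneg hM
  refine cstarMatrix_nonneg_of_quadraticForm_nonneg ?_ fun X => ?_
  · ext1 i j
    simp only [CStarMatrix.star_apply, CStarMatrix.map_apply, ContinuousLinearMap.star_eq_adjoint,
      ContinuousLinearMap.adjoint_comp, ContinuousLinearMap.adjoint_adjoint,
      ContinuousLinearMap.comp_assoc]
    rw [← ContinuousLinearMap.star_eq_adjoint, ← CStarMatrix.star_apply, star_mul, star_star]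
  · let Y (k : n) : K →L[ℂ] H := ∑ j, B k j ∘L adjoint T ∘L X j
    calc (0 : K →L[ℂ] K) ≤ ∑ k, adjoint (Y k) ∘L Y k := Finset.sum_nonneg fun k _ =>
          (ContinuousLinearMap.nonneg_iff_isPositive _).mpr
            (ContinuousLinearMap.isPositive_adjoint_comp_self _)
      _ = ∑ k, ∑ i, ∑ j, star (X i) * (T ∘L (star (B k i) * B k j) ∘L adjoint T) * X j := by
          simp only [Y, map_sum, ContinuousLinearMap.finsetSum_comp,
            ContinuousLinearMap.comp_finsetSum, ContinuousLinearMap.adjoint_comp,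
            ContinuousLinearMap.adjoint_adjoint, ContinuousLinearMap.mul_def,
            ContinuousLinearMap.star_eq_adjoint, ContinuousLinearMap.comp_assoc]
          exact Finset.sum_congr rfl fun k _ => Finset.sum_comm
      _ = ∑ i, star (X i) * ∑ j, (star B * B).map (fun x => T ∘L x ∘L adjoint T) i j * X j := by
          rw [Finset.sum_comm]
          refine Finset.sum_congr rfl fun i _ => ?_
          rw [Finset.sum_comm, Finset.mul_sum]
          refine Finset.sum_congr rfl fun j _ => ?_
          simp only [CStarMatrix.map_apply, CStarMatrix.mul_apply, CStarMatrix.star_apply,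
            ContinuousLinearMap.finsetSum_comp, ContinuousLinearMap.comp_finsetSum,
            Finset.mul_sum, Finset.sum_mul, mul_assoc]

variable {ι : Type*} (s : Finset ι) (A : ι → H →L[ℂ] K)

/-- The completely positive map `x ↦ ∑ i ∈ s, A i x (A i)†` with Kraus operators `A i`. -/
def ofKraus : (H →L[ℂ] H) →CP (K →L[ℂ] K) where
  toFun x := ∑ i ∈ s, A i ∘L x ∘L adjoint (A i)
  map_add' x y := by
    simp only [ContinuousLinearMap.add_comp, ContinuousLinearMap.comp_add, Finset.sum_add_distrib]
  map_smul' c x := by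
    simp only [ContinuousLinearMap.smul_comp, ContinuousLinearMap.comp_smul, Finset.smul_sum,
      RingHom.id_apply]
  map_cstarMatrix_nonneg' k M hM := by
    have hsum : 0 ≤ ∑ i ∈ s, M.map fun x => A i ∘L x ∘L adjoint (A i) :=
      Finset.sum_nonneg fun i _ => map_conj_nonneg (A i) hM
    convert hsum using 1
    ext1 a b
    exact (Matrix.sum_apply a b s fun i => M.map fun x => A i ∘L x ∘L adjoint (A i)).symm

lemma ofKraus_one : ofKraus s A 1 = ∑ i ∈ s, A i ∘L adjoint (A i) := rfl

lemma ofKraus_rankOne (x y : H) :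
    ofKraus s A (rankOne ℂ x y) = ∑ i ∈ s, rankOne ℂ (A i x) (A i y) := by
  refine Finset.sum_congr rfl fun i _ => ?_
  rw [InnerProductSpace.rankOne_comp, InnerProductSpace.comp_rankOne,
    ContinuousLinearMap.adjoint_adjoint]

end Kraus

section Isometry

variable {𝕜 K : Type*} [RCLike 𝕜] [NormedAddCommGroup K] [InnerProductSpace 𝕜 K]
  [CompleteSpace K]

lemma adjoint_comp_toContinuousLinearMap {E : Type*} [NormedAddCommGroup E] [InnerProductSpace 𝕜 E]
    [CompleteSpace E] (V : E →ₗᵢ[𝕜] K) :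
    adjoint V.toContinuousLinearMap ∘L V.toContinuousLinearMap = 1 :=
  (ContinuousLinearMap.isometry_iff_adjoint_comp_self _).mp V.isometry

variable {ι : Type*} {E : ι → Type*} [∀ i, NormedAddCommGroup (E i)]
  [∀ i, InnerProductSpace 𝕜 (E i)] [∀ i, CompleteSpace (E i)] {B : ∀ i, E i →ₗᵢ[𝕜] K}

lemma adjoint_comp_eq_zero_of_orthogonalFamily (hB : OrthogonalFamily 𝕜 E B) {i j : ι}
    (hij : i ≠ j) :
    adjoint (B i).toContinuousLinearMap ∘L (B j).toContinuousLinearMap = 0 := by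
  ext x
  refine ext_inner_left 𝕜 fun y => ?_
  rw [ContinuousLinearMap.comp_apply, ContinuousLinearMap.adjoint_inner_right]
  simpa using hB hij y x

lemma sum_comp_adjoint_le_one (hB : OrthogonalFamily 𝕜 E B) (s : Finset ι) :
    ∑ i ∈ s, (B i).toContinuousLinearMap ∘L adjoint (B i).toContinuousLinearMap ≤ 1 := by
  refine (ContinuousLinearMap.le_def _ _).mpr
    (ContinuousLinearMap.IsPositive.of_isStarProjection (IsStarProjection.one_sub ⟨?_, ?_⟩))
  · rw [IsIdempotentElem, Finset.sum_mul]
    refine Finset.sum_congr rfl fun i hi => ?_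
    rw [Finset.mul_sum, Finset.sum_eq_single_of_mem i hi]
    · rw [ContinuousLinearMap.mul_def, ContinuousLinearMap.comp_assoc,
        ← ContinuousLinearMap.comp_assoc (adjoint _), adjoint_comp_toContinuousLinearMap]
      rfl
    · intro j _ hji
      rw [ContinuousLinearMap.mul_def, ContinuousLinearMap.comp_assoc,
        ← ContinuousLinearMap.comp_assoc (adjoint _),
        adjoint_comp_eq_zero_of_orthogonalFamily hB hji.symm, ContinuousLinearMap.zero_comp,
        ContinuousLinearMap.comp_zero]
  · rw [isSelfAdjoint_iff, star_sum]
    refine Finset.sum_congr rfl fun i _ => ?_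
    rw [ContinuousLinearMap.star_eq_adjoint, ContinuousLinearMap.adjoint_comp,
      ContinuousLinearMap.adjoint_adjoint]

end Isometry

section KrausOperator

variable {E H K : Type*} [NormedAddCommGroup E] [InnerProductSpace ℂ E] [CompleteSpace E]
  [NormedAddCommGroup H] [InnerProductSpace ℂ H] [CompleteSpace H]
  [NormedAddCommGroup K] [InnerProductSpace ℂ K] {d : ℕ}

/-- The operator `x ↦ J (V†x ⊗ eᵢ)`, the `i`-th Kraus operator of the map
`T ↦ J (V†TV ⊗ I_d) J†`. -/
def krausOperator (V : E →ₗᵢ[ℂ] H) (J : E ⊗[ℂ] EuclideanSpace ℂ (Fin d) →ₗᵢ[ℂ] K) (i : Fin d) :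
    H →L[ℂ] K :=
  (slice J i).toContinuousLinearMap ∘L adjoint V.toContinuousLinearMap

lemma sum_rankOne_krausOperator (V : E →ₗᵢ[ℂ] H)
    (J : E ⊗[ℂ] EuclideanSpace ℂ (Fin d) →ₗᵢ[ℂ] K) (x : H) :
    ∑ i, rankOne ℂ (krausOperator V J i x) (krausOperator V J i x) =
      amplification J (adjoint V.toContinuousLinearMap x) := rfl

lemma krausOperator_comp_adjoint [CompleteSpace K] (V : E →ₗᵢ[ℂ] H)
    (J : E ⊗[ℂ] EuclideanSpace ℂ (Fin d) →ₗᵢ[ℂ] K) (i : Fin d) :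
    krausOperator V J i ∘L adjoint (krausOperator V J i) =
      (slice J i).toContinuousLinearMap ∘L adjoint (slice J i).toContinuousLinearMap := by
  rw [krausOperator, ContinuousLinearMap.adjoint_comp, ContinuousLinearMap.adjoint_adjoint,
    ContinuousLinearMap.comp_assoc, ← ContinuousLinearMap.comp_assoc (adjoint _),
    adjoint_comp_toContinuousLinearMap]
  rfl

end KrausOperator

section Sufficiency

variable {Θ H G K : Type*} [NormedAddCommGroup H] [InnerProductSpace ℂ H]
  [NormedAddCommGroup G] [InnerProductSpace ℂ G] [FiniteDimensional ℂ G]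
  [NormedAddCommGroup K] [InnerProductSpace ℂ K] {u : Θ → H} {L : Θ → H →L[ℂ] H} {v : Θ → G}

lemma finite_blockSpan_ne_bot (hL : ∀ θ, L θ = rankOne ℂ (u θ) (u θ))
    (huv : UnitarilyEquivalent u v) : {κ | blockSpan L v κ ≠ ⊥}.Finite :=
  WellFoundedGT.finite_ne_bot_of_iSupIndep (OrthogonalFamily.of_pairwise fun _ _ =>
    isOrtho_blockSpan hL (inner_eq_of_unitarilyEquivalent huv)).independent

variable [CompleteSpace H]

lemma exists_blockIsometry_adjoint_apply (hL : ∀ θ, L θ = rankOne ℂ (u θ) (u θ))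
    (huv : UnitarilyEquivalent u v) :
    ∃ V : ∀ κ, blockSpan L v κ →ₗᵢ[ℂ] H,
      (∀ θ, adjoint (V (component L θ)).toContinuousLinearMap (u θ) = blockVec L v θ) ∧
      ∀ κ θ, κ ≠ component L θ → adjoint (V κ).toContinuousLinearMap (u θ) = 0 := by
  obtain ⟨W, hW⟩ := exists_blockIsometry L huv
  refine ⟨fun κ => (blockSpan L u κ).subtypeₗᵢ.comp (W κ), fun θ => ?_, fun κ θ hκ => ?_⟩
  · have hu : u θ = ((blockSpan L u _).subtypeₗᵢ.comp (W _)).toContinuousLinearMap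
        (blockVec L v θ) := (congrArg Subtype.val (hW θ)).symm
    rw [hu, ← ContinuousLinearMap.comp_apply, adjoint_comp_toContinuousLinearMap]
    rfl
  · refine ext_inner_left ℂ fun y => ?_
    rw [ContinuousLinearMap.adjoint_inner_right, inner_zero_right]
    exact (isOrtho_blockSpan hL (fun _ _ => rfl) hκ).inner_eq (W κ y).2 (blockVec L u θ).2

lemma exists_completelyPositiveMap_of_orthogonalFamily [CompleteSpace K]
    (hL : ∀ θ, L θ = rankOne ℂ (u θ) (u θ)) (huv : UnitarilyEquivalent u v)
    {d : Component L → ℕ} {J : ∀ κ, blockSpan L v κ ⊗[ℂ] EuclideanSpace ℂ (Fin (d κ)) →ₗᵢ[ℂ] K}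
    (hJ : OrthogonalFamily ℂ (fun κ => blockSpan L v κ ⊗[ℂ] EuclideanSpace ℂ (Fin (d κ))) J) :
    ∃ Λ : (H →L[ℂ] H) →CP (K →L[ℂ] K), Λ 1 ≤ 1 ∧
      ∀ θ, Λ (L θ) = amplification (J (component L θ)) (blockVec L v θ) := by
  obtain ⟨V, hVu, hVu_zero⟩ := exists_blockIsometry_adjoint_apply hL huv
  have hfin := finite_blockSpan_ne_bot hL huv
  refine ⟨ofKraus (hfin.toFinset.sigma fun _ => Finset.univ) fun p : Σ κ, Fin (d κ) =>
    krausOperator (V p.1) (J p.1) p.2, ?_, fun θ => ?_⟩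
  · simp only [ofKraus_one, krausOperator_comp_adjoint]
    exact sum_comp_adjoint_le_one (orthogonalFamily_slice hJ) _
  · rw [hL, ofKraus_rankOne, Finset.sum_sigma, Finset.sum_congr rfl fun κ _ =>
      sum_rankOne_krausOperator (V κ) (J κ) (u θ), Finset.sum_eq_single (component L θ), hVu]
    · intro κ _ hκ
      rw [hVu_zero κ θ hκ, amplification_zero]
    · intro hθ
      have hbot : blockSpan L v (component L θ) = ⊥ := by simpa using hθ
      have := Submodule.subsingleton_iff_eq_bot.mpr hbot
      rw [hVu, Subsingleton.elim (blockVec L v θ) 0, amplification_zero]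

end Sufficiency

end ObsConv

end

theorem mainTheorem9_general {Θ : Type*}
    {H : Type*} [NormedAddCommGroup H] [InnerProductSpace ℂ H] [CompleteSpace H]
    {K : Type*} [NormedAddCommGroup K] [InnerProductSpace ℂ K] [CompleteSpace K]
    [FiniteDimensional ℂ K]
    (u : Θ → H) (L : Θ → H →L[ℂ] H) (M : Θ → K →L[ℂ] K)
    (hL : ∀ θ, L θ = InnerProductSpace.rankOne ℂ (u θ) (u θ))
    (hM : ∀ θ, ∃ (c : ℝ) (P : K →L[ℂ] K), 0 ≤ c ∧ IsStarProjection P ∧ M θ = (c : ℂ) • P)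
    (hnorm : ∀ θ, ‖L θ‖ = ‖M θ‖) :
    (∃ Λ : (H →L[ℂ] H) →CP (K →L[ℂ] K), Λ 1 ≤ 1 ∧ ∀ θ, Λ (L θ) = M θ) ↔
    (∃ (n : ℕ) (v : Θ → EuclideanSpace ℂ (Fin n)) (d : ObsConv.Component L → ℕ)
      (J : ∀ κ : ObsConv.Component L,
        (ObsConv.blockSpan L v κ ⊗[ℂ] EuclideanSpace ℂ (Fin (d κ))) →ₗᵢ[ℂ] K),
      ObsConv.UnitarilyEquivalent u v ∧
      (∀ κ, 0 < d κ) ∧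
      OrthogonalFamily ℂ
        (fun κ => ObsConv.blockSpan L v κ ⊗[ℂ] EuclideanSpace ℂ (Fin (d κ))) J ∧
      ∀ θ, (M θ).toLinearMap =
        ObsConv.embedOp (J (ObsConv.component L θ))
          (ObsConv.rankOneTensorId (ObsConv.blockVec L v θ) (d (ObsConv.component L θ)))) := by
  constructor
  · rintro ⟨Λ, hΛ, hΛL⟩
    simp only [← hΛL] at hM hnorm ⊢
    refine ObsConv.exists_embedOp_of_mem_multiplicativeDomain hL (fun θ => ?_) fun θ hLθ => ?_
    · have hnormθ := hnorm θ
      have hMθ := hM θ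
      rw [hL] at hnormθ hMθ ⊢
      exact ObsConv.rankOne_self_mem_multiplicativeDomain hΛ hMθ hnormθ
    · rwa [← norm_ne_zero_iff, ← hnorm, norm_ne_zero_iff]
  · rintro ⟨n, v, d, J, huv, -, hJ, hMJ⟩
    obtain ⟨Λ, hΛ, hΛL⟩ := ObsConv.exists_completelyPositiveMap_of_orthogonalFamily hL huv hJ
    refine ⟨Λ, hΛ, fun θ => ContinuousLinearMap.coe_inj.mp ?_⟩
    rw [hMJ, hΛL, ObsConv.embedOp_rankOneTensorId]

theorem mainTheorem9 {Θ : Type*} [Finite Θ]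
    {H : Type*} [NormedAddCommGroup H] [InnerProductSpace ℂ H] [CompleteSpace H]
    [FiniteDimensional ℂ H]
    {K : Type*} [NormedAddCommGroup K] [InnerProductSpace ℂ K] [CompleteSpace K]
    [FiniteDimensional ℂ K]
    (u : Θ → H) (L : Θ → H →L[ℂ] H) (M : Θ → K →L[ℂ] K)
    (hL : ∀ θ, L θ = InnerProductSpace.rankOne ℂ (u θ) (u θ))
    (hM : ∀ θ, ∃ (c : ℝ) (P : K →L[ℂ] K), 0 ≤ c ∧ IsStarProjection P ∧ M θ = (c : ℂ) • P)
    (hnorm : ∀ θ, ‖L θ‖ = ‖M θ‖) :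
    (∃ Λ : (H →L[ℂ] H) →CP (K →L[ℂ] K), Λ 1 ≤ 1 ∧ ∀ θ, Λ (L θ) = M θ) ↔
    (∃ (n : ℕ) (v : Θ → EuclideanSpace ℂ (Fin n)) (d : ObsConv.Component L → ℕ)
      (J : ∀ κ : ObsConv.Component L,
        (ObsConv.blockSpan L v κ ⊗[ℂ] EuclideanSpace ℂ (Fin (d κ))) →ₗᵢ[ℂ] K),
      ObsConv.UnitarilyEquivalent u v ∧
      (∀ κ, 0 < d κ) ∧
      OrthogonalFamily ℂ
        (fun κ => ObsConv.blockSpan L v κ ⊗[ℂ] EuclideanSpace ℂ (Fin (d κ))) J ∧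
      ∀ θ, (M θ).toLinearMap =
        ObsConv.embedOp (J (ObsConv.component L θ))
          (ObsConv.rankOneTensorId (ObsConv.blockVec L v θ) (d (ObsConv.component L θ)))) :=
  mainTheorem9_general u L M hL hM hnorm
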